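/- Conventions. A graph may have loops and multiple edges and is regarded as a metric graph with all edges of length $1$. A graph is finite if it has finitely many vertices and edges. Morphisms of graphs map vertices to vertices and restrict to local isometries on edges (formally, they are maps of vertices and of oriented edges that respect initial vertices and reversal of orientation). A covering $X\to Y$ is a morphism that is surjective and maps, for each vertex $v$ of $X$, the oriented edges starting at $v$ bijectively onto the oriented edges starting at the image of $v$; $X$ covers $Y$ if a covering $X\to Y$ exists. A quasitree is a connected locally finite graph that is quasi-isometric to a tree. $\mathrm{Aut}(X)$ is the group of automorphisms of $X$, with the compact-open topology; $X$ is cocompact if there are only finitely many $\mathrm{Aut}(X)$-orbits of vertices and of edges. A uniform lattice in $\mathrm{Aut}(X)$ is a discrete subgroup $\Gamma\le\mathrm{Aut}(X)$ that acts properly and cocompactly on $X$. Theorem. There exist a cocompact quasitree $X$ and finite graphs $X_1$ and $X_2$ such that $X$ covers $X_1$ and $X$ covers $X_2$, but there is no finite graph $\hat X$ such that $X$ covers $\hat X$ and $\hat X$ covers both $X_1$ and $X_2$ (the compositions $X\to\hat X\to X_i$ are not required to be any prescribed coverings). Moreover, $X$, $X_1$, $X_2$ can be chosen so that, in addition, $\mathrm{Aut}(X)$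 contains no uniform lattice. -/

import Mathlib

/-- A graph in the sense of Serre; loops and multiple edges are allowed. `E` is the set of oriented
edges, `src e` is the initial vertex of `e` and `inv e` is `e` with the opposite orientation, so that
the (unoriented) edges are the pairs `{e, inv e}`; a loop contributes two oriented edges at its
vertex. Such a graph is regarded as a metric graph with all edges of length one. -/
structure SerreGraph where
  V : Type
  E : Type
  src : E → V
  inv : E → E
  inv_inv : ∀ e, inv (inv e) = e
  inv_ne : ∀ e, inv e ≠ e

namespace SerreGraph

/-- The terminal vertex of an oriented edge. -/
def tgt (X : SerreGraph) (e : X.E) : X.V := X.src (X.inv e)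

/-- The set of oriented edges issuing from a vertex. -/
def starAt (X : SerreGraph) (v : X.V) : Set X.E := {e | X.src e = v}

/-- A finite graph: finitely many vertices and edges. -/
def IsFinite (X : SerreGraph) : Prop := Finite X.V ∧ Finite X.E

/-- Every vertex has finite valence. -/
def LocallyFinite (X : SerreGraph) : Prop := ∀ v : X.V, (X.starAt v).Finite

/-- A morphism of graphs: it maps vertices to vertices and oriented edges to oriented edges,
respecting initial vertices and orientation reversal (hence also terminal vertices). -/
structure Hom (X Y : SerreGraph) where
  onV : X.V → Y.V
  onE : X.E → Y.E
  src_onE : ∀ e, Y.src (onE e) = onV (X.src e)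
  inv_onE : ∀ e, Y.inv (onE e) = onE (X.inv e)

/-- A covering map: surjective, and a bijection from the star of each vertex onto the star
of its image. -/
def Hom.IsCovering {X Y : SerreGraph} (f : Hom X Y) : Prop :=
  Function.Surjective f.onV ∧ ∀ v : X.V, Set.BijOn f.onE (X.starAt v) (Y.starAt (f.onV v))

/-- `X` covers `Y`. -/
def Covers (X Y : SerreGraph) : Prop := ∃ f : Hom X Y, f.IsCovering

/-- The simple graph on the same vertices, in which distinct vertices are adjacent iff some edge
joins them. It has the same connectedness and the same path metric on vertices as the graph. -/
def toSimple (X : SerreGraph) : SimpleGraph X.V where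
  Adj u v := u ≠ v ∧ ∃ e, X.src e = u ∧ X.tgt e = v
  symm := ⟨fun u v h => by
    obtain ⟨hne, e, h1, h2⟩ := h
    exact ⟨hne.symm, X.inv e, h2, by rw [tgt, X.inv_inv, h1]⟩⟩
  loopless := ⟨fun _ h => h.1 rfl⟩

end SerreGraph

/-- `f` is a quasi-isometry between the vertex sets of two connected graphs, with their path metrics
(a connected metric graph is within distance one half of its vertex set). -/
def IsGraphQuasiIsometry {V W : Type} (G : SimpleGraph V) (H : SimpleGraph W) (f : V → W) : Prop :=
  ∃ K C : ℝ, 1 ≤ K ∧ 0 ≤ C ∧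
    (∀ x y : V, (G.dist x y : ℝ) / K - C ≤ (H.dist (f x) (f y) : ℝ) ∧
      (H.dist (f x) (f y) : ℝ) ≤ K * (G.dist x y : ℝ) + C) ∧
    ∀ w : W, ∃ x : V, (H.dist (f x) w : ℝ) ≤ C

namespace SerreGraph

/-- A quasitree: a connected locally finite graph that is quasi-isometric to a tree. -/
def IsQuasitree (X : SerreGraph) : Prop :=
  X.LocallyFinite ∧ X.toSimple.Connected ∧
    ∃ (W : Type) (T : SimpleGraph W), T.IsTree ∧
      ∃ f : X.V → W, IsGraphQuasiIsometry X.toSimple T f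

/-- The automorphism group: pairs of permutations of the vertices and of the oriented edges that
respect initial vertices and orientation reversal. -/
def Aut (X : SerreGraph) : Subgroup (Equiv.Perm X.V × Equiv.Perm X.E) where
  carrier := {g | (∀ e, X.src (g.2 e) = g.1 (X.src e)) ∧ ∀ e, X.inv (g.2 e) = g.2 (X.inv e)}
  one_mem' := ⟨fun _ => rfl, fun _ => rfl⟩
  mul_mem' := fun {a b} ha hb =>
    ⟨fun e => by simp [ha.1, hb.1], fun e => by simp [ha.2, hb.2]⟩
  inv_mem' := fun {a} ha =>
    ⟨fun e => by
      have h := ha.1 (a.2.symm e)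
      rw [Equiv.apply_symm_apply] at h
      exact (a.1.symm_apply_eq.mpr h).symm,
    fun e => by
      have h := ha.2 (a.2.symm e)
      rw [Equiv.apply_symm_apply] at h
      exact (a.2.symm_apply_eq.mpr h).symm⟩

/-- The action of automorphisms on vertices. -/
instance instMulActionV (X : SerreGraph) : MulAction X.Aut X.V where
  smul g v := g.1.1 v
  one_smul _ := rfl
  mul_smul _ _ _ := rfl

/-- The action of automorphisms on oriented edges. -/
instance instMulActionE (X : SerreGraph) : MulAction X.Aut X.E where
  smul g e := g.1.2 e
  one_smul _ := rfl
  mul_smul _ _ _ := rfl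

/-- The topology of pointwise convergence on vertices and oriented edges, both discrete. This is the
compact-open topology of the automorphism group acting on the metric graph. -/
instance instTopologicalSpaceAut (X : SerreGraph) : TopologicalSpace X.Aut :=
  TopologicalSpace.induced (fun g => ((fun v => g • v : X.V → X.V), (fun e => g • e : X.E → X.E)))
    (@instTopologicalSpaceProd (X.V → X.V) (X.E → X.E)
      (@Pi.topologicalSpace X.V (fun _ => X.V) (fun _ => ⊥))
      (@Pi.topologicalSpace X.E (fun _ => X.E) (fun _ => ⊥)))

/-- `Γ` acts cocompactly: there are finitely many orbits of vertices and of edges. -/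
def ActsCocompactly {X : SerreGraph} (Γ : Subgroup X.Aut) : Prop :=
  Finite (MulAction.orbitRel.Quotient Γ X.V) ∧ Finite (MulAction.orbitRel.Quotient Γ X.E)

/-- `Γ` acts properly: for every finite set `S` of vertices only finitely many `γ ∈ Γ` satisfy
`γ S ∩ S ≠ ∅`. Vertices suffice: a compact set `K` lies in a finite subgraph, and if `γ K` meets `K`
then `γ` maps some vertex of this subgraph to a vertex of it. -/
def ActsProperly {X : SerreGraph} (Γ : Subgroup X.Aut) : Prop :=
  ∀ S : Set X.V, S.Finite → {γ : Γ | ∃ v ∈ S, γ • v ∈ S}.Finite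

/-- A uniform lattice: a discrete subgroup of the automorphism group that acts properly and
cocompactly. -/
def IsUniformLattice {X : SerreGraph} (Γ : Subgroup X.Aut) : Prop :=
  DiscreteTopology Γ ∧ ActsProperly Γ ∧ ActsCocompactly Γ

/-- A cocompact graph: the full automorphism group acts cocompactly. -/
def IsCocompact (X : SerreGraph) : Prop := ActsCocompactly (⊤ : Subgroup X.Aut)

end SerreGraph

/-!
If a group acts properly and cocompactly on a graph, weigh each orbit of vertices by the inverse of
the order of the stabilizers. Counting the orbits of edges between two invariant colour classes from
both ends shows that these masses form a reversible measure for the edge counts, which therefore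
satisfy Kolmogorov's cycle criterion. The vertices of the quasitree have colours `a`, `b` and `c`
whose edge counts violate it, so no such group can preserve these colours.

The colours are encoded by decorations: the vertices `a` carry a twist of order two and the vertices
`b` a twist of order three. One finite quotient retains only the first, the other only the second. A
covering cannot increase the order of a twist, so the first quotient recognizes `a`, the second
recognizes `b`, and a graph covering both recognizes all three colours.
-/

open scoped ENNReal

namespace SerreGraph

/-! ### Group actions with finite stabilizers -/

section FundamentalDensity

variable {G A B : Type*} [Group G] [MulAction G A] [MulAction G B]

/-- A fundamental domain with multiplicities: a weight function whose sum over the translates of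
every point is `1`. Summing an invariant function against it counts orbits, each weighted by the
inverse of the order of its stabilizer. -/
def IsFundamentalDensity (G : Type*) {A : Type*} [Group G] [MulAction G A] (ρ : A → ℝ≥0∞) : Prop :=
  ∀ a, ∑' g : G, ρ (g • a) = 1

theorem IsFundamentalDensity.comp {ρ : B → ℝ≥0∞} (hρ : IsFundamentalDensity G ρ) {π : A → B}
    (hπ : ∀ (g : G) a, π (g • a) = g • π a) : IsFundamentalDensity G (ρ ∘ π) := fun a => by
  simpa only [Function.comp_apply, hπ] using hρ (π a)

theorem IsFundamentalDensity.tsum_mul_eq {ρ ρ' : A → ℝ≥0∞} (hρ : IsFundamentalDensity G ρ)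
    (hρ' : IsFundamentalDensity G ρ') {w : A → ℝ≥0∞} (hw : ∀ (g : G) a, w (g • a) = w a) :
    ∑' a, ρ a * w a = ∑' a, ρ' a * w a := by
  calc ∑' a, ρ a * w a
      = ∑' a, ∑' g : G, ρ a * w a * ρ' (g • a) := by
        simp only [ENNReal.tsum_mul_left, hρ' _, mul_one]
    _ = ∑' g : G, ∑' a, ρ a * w a * ρ' (g • a) := ENNReal.tsum_comm
    _ = ∑' g : G, ∑' a, ρ (g⁻¹ • a) * w a * ρ' a := tsum_congr fun g => by
        rw [← (MulAction.toPerm g⁻¹).tsum_eq fun a => ρ a * w a * ρ' (g • a)]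
        simp only [MulAction.toPerm_apply, smul_inv_smul, hw]
    _ = ∑' a, ∑' g : G, ρ' a * w a * ρ (g⁻¹ • a) := by
        rw [ENNReal.tsum_comm]
        exact tsum_congr fun a => tsum_congr fun g => by ring
    _ = ∑' a, ρ' a * w a := tsum_congr fun a => by
        have hinv : ∑' g : G, ρ (g⁻¹ • a) = 1 :=
          ((Equiv.inv G).tsum_eq fun g => ρ (g • a)).trans (hρ a)
        rw [ENNReal.tsum_mul_left, hinv, mul_one]

theorem IsFundamentalDensity.exists_smul_ne_zero {ρ : A → ℝ≥0∞} (hρ : IsFundamentalDensity G ρ)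
    (a : A) : ∃ g : G, ρ (g • a) ≠ 0 := by
  by_contra! h
  simpa [h] using hρ a

/-- Normalize the indicator of a finite set of representatives of the orbits. -/
theorem exists_isFundamentalDensity [Finite (MulAction.orbitRel.Quotient G A)]
    (hfin : ∀ S : Set A, S.Finite → {g : G | ∃ a ∈ S, g • a ∈ S}.Finite) :
    ∃ ρ : A → ℝ≥0∞, IsFundamentalDensity G ρ ∧ ∑' a, ρ a ≠ ∞ := by
  classical
  let S : Set A := Set.range (Quotient.out : MulAction.orbitRel.Quotient G A → A)
  have hS : S.Finite := Set.finite_range _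
  let c : A → ℕ∞ := fun a => {g : G | g • a ∈ S}.encard
  have hc (g : G) (a : A) : c (g • a) = c a := by
    refine Set.encard_congr ((Equiv.mulRight g).subtypeEquiv fun x => ?_)
    simp [mul_smul]
  have hc_ne_top (a : A) : c a ≠ ⊤ := by
    rw [Set.encard_ne_top_iff]
    exact (hfin _ (hS.insert a)).subset fun g hg => ⟨a, by simp, Set.mem_insert_of_mem _ hg⟩
  have hc_ne_zero (a : A) : c a ≠ 0 := by
    obtain ⟨g, hg⟩ := Quotient.exact (s := MulAction.orbitRel G A) (Quotient.out_eq' ⟦a⟧)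
    exact Set.encard_ne_zero.mpr ⟨g, _, hg.symm⟩
  refine ⟨S.indicator fun a => (c a : ℝ≥0∞)⁻¹, fun a => ?_, ?_⟩
  · calc ∑' g : G, S.indicator (fun a => (c a : ℝ≥0∞)⁻¹) (g • a)
        = ∑' g : G, {g : G | g • a ∈ S}.indicator (fun _ => (c a : ℝ≥0∞)⁻¹) g :=
          tsum_congr fun g => by simp only [Set.indicator_apply, hc, Set.mem_ofPred_eq]
      _ = c a * (c a : ℝ≥0∞)⁻¹ := by
          rw [← tsum_subtype, ENNReal.tsum_set_const]
      _ = 1 := ENNReal.mul_inv_cancel (by simpa using hc_ne_zero a) (by simpa using hc_ne_top a)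
  · have := hS.fintype
    rw [← tsum_subtype, tsum_fintype]
    exact ENNReal.sum_ne_top.mpr fun a _ => ENNReal.inv_ne_top.mpr (by simpa using hc_ne_zero a)

end FundamentalDensity

/-! ### Coverings -/

theorem Hom.tgt_onE {X Y : SerreGraph} (f : Hom X Y) (e : X.E) :
    Y.tgt (f.onE e) = f.onV (X.tgt e) := by
  rw [tgt, f.inv_onE, f.src_onE, tgt]

/-- Composition of morphisms. -/
def Hom.comp {X Y Z : SerreGraph} (g : Hom Y Z) (f : Hom X Y) : Hom X Z where
  onV := g.onV ∘ f.onV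
  onE := g.onE ∘ f.onE
  src_onE e := by simp only [Function.comp_apply, g.src_onE, f.src_onE]
  inv_onE e := by simp only [Function.comp_apply, g.inv_onE, f.inv_onE]

theorem Hom.isCovering_of_exists_lift {X Y : SerreGraph} {f : Hom X Y}
    (hV : Function.Surjective f.onV)
    (hinj : ∀ e e', X.src e = X.src e' → f.onE e = f.onE e' → e = e')
    (hlift : ∀ v e', Y.src e' = f.onV v → ∃ e, X.src e = v ∧ f.onE e = e') : f.IsCovering :=
  ⟨hV, fun _ => ⟨fun e he => (f.src_onE e).trans (congrArg f.onV he),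
    fun e he e' he' => hinj e e' (he.trans he'.symm), hlift _⟩⟩

theorem Hom.IsCovering.comp {X Y Z : SerreGraph} {g : Hom Y Z} {f : Hom X Y}
    (hg : g.IsCovering) (hf : f.IsCovering) : (g.comp f).IsCovering :=
  ⟨hg.1.comp hf.1, fun v => (hg.2 (f.onV v)).comp (hf.2 v)⟩

theorem Hom.IsCovering.exists_lift {X Y : SerreGraph} {f : Hom X Y} (hf : f.IsCovering) {v : X.V}
    {e' : Y.E} (he' : Y.src e' = f.onV v) : ∃ e, X.src e = v ∧ f.onE e = e' :=
  (hf.2 v).surjOn he'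

theorem Hom.IsCovering.encard_starAt {X Y : SerreGraph} {f : Hom X Y} (hf : f.IsCovering)
    (v : X.V) : (Y.starAt (f.onV v)).encard = (X.starAt v).encard := by
  rw [← (hf.2 v).image_eq, (hf.2 v).injOn.encard_image]

theorem src_smul {X : SerreGraph} (g : X.Aut) (e : X.E) : X.src (g • e) = g • X.src e :=
  g.2.1 e

theorem inv_smul {X : SerreGraph} (g : X.Aut) (e : X.E) : X.inv (g • e) = g • X.inv e :=
  g.2.2 e

theorem tgt_smul {X : SerreGraph} (g : X.Aut) (e : X.E) : X.tgt (g • e) = g • X.tgt e := by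
  rw [tgt, inv_smul, src_smul, tgt]

/-- The morphism underlying an automorphism. -/
def autHom {X : SerreGraph} (g : X.Aut) : Hom X X where
  onV v := g • v
  onE e := g • e
  src_onE := g.2.1
  inv_onE := g.2.2

theorem autHom_isCovering {X : SerreGraph} (g : X.Aut) : (autHom g).IsCovering :=
  Hom.isCovering_of_exists_lift (MulAction.surjective g)
    (fun _ _ _ h => MulAction.injective g h) fun _ e he =>
      ⟨g⁻¹ • e, (src_smul g⁻¹ e).trans (inv_smul_eq_iff.mpr he), smul_inv_smul g e⟩

theorem Hom.IsCovering.bijective_onE {X Y : SerreGraph} {f : Hom X Y} (hf : f.IsCovering)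
    (hinj : Function.Injective f.onV) : Function.Bijective f.onE := by
  constructor
  · intro e e' h
    have hsrc : X.src e = X.src e' := hinj (by rw [← f.src_onE, ← f.src_onE, h])
    exact (hf.2 _).injOn hsrc rfl h
  · intro e'
    obtain ⟨v, hv⟩ := hf.1 (Y.src e')
    obtain ⟨e, -, he⟩ := hf.exists_lift hv.symm
    exact ⟨e, he⟩

/-- The automorphism given by an injective covering of a graph by itself. -/
noncomputable def Hom.IsCovering.toAut {X : SerreGraph} {f : Hom X X} (hf : f.IsCovering)
    (hinj : Function.Injective f.onV) : X.Aut :=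
  ⟨(.ofBijective f.onV ⟨hinj, hf.1⟩, .ofBijective f.onE (hf.bijective_onE hinj)),
    f.src_onE, f.inv_onE⟩

/-! ### Counting edges between colour classes -/

section EdgeCount

variable {X : SerreGraph} {K : Type*}

/-- Every vertex of colour `s` has exactly `n` edges to vertices of colour `t`. -/
def HasEdgeCount (X : SerreGraph) (τ : X.V → K) (s t : K) (n : ℕ) : Prop :=
  ∀ v, τ v = s → {e | X.src e = v ∧ τ (X.tgt e) = t}.encard = n

theorem HasEdgeCount.of_covering {Y : SerreGraph} {f : Hom X Y} (hf : f.IsCovering) {τ : Y.V → K}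
    {s t : K} {n : ℕ} (h : HasEdgeCount X (τ ∘ f.onV) s t n) : HasEdgeCount Y τ s t n := by
  intro u hu
  obtain ⟨v, rfl⟩ := hf.1 u
  have himage : {e | Y.src e = f.onV v ∧ τ (Y.tgt e) = t} =
      f.onE '' {e | X.src e = v ∧ (τ ∘ f.onV) (X.tgt e) = t} := by
    ext e
    constructor
    · rintro ⟨hsrc, htgt⟩
      obtain ⟨e, he, rfl⟩ := hf.exists_lift hsrc
      exact ⟨e, ⟨he, by rwa [f.tgt_onE] at htgt⟩, rfl⟩
    · rintro ⟨e, ⟨rfl, htgt⟩, rfl⟩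
      exact ⟨f.src_onE e, by rwa [f.tgt_onE]⟩
  rw [himage, ((hf.2 v).injOn.mono fun e he => he.1).encard_image, h v hu]

/-- The oriented edges from vertices of colour `s` to vertices of colour `t`. -/
def edgesBetween (X : SerreGraph) (τ : X.V → K) (s t : K) : Set X.E :=
  {e | τ (X.src e) = s ∧ τ (X.tgt e) = t}

/-- The total weight of the vertices of colour `k`. -/
noncomputable def colorMass {A : Type*} (ρ : A → ℝ≥0∞) (τ : A → K) (k : K) : ℝ≥0∞ :=
  ∑' v, (τ ⁻¹' {k}).indicator ρ v

theorem HasEdgeCount.tsum_src_mul_indicator {τ : X.V → K} {s t : K} {n : ℕ}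
    (h : HasEdgeCount X τ s t n) (ρ : X.V → ℝ≥0∞) :
    ∑' e, ρ (X.src e) * (X.edgesBetween τ s t).indicator 1 e = colorMass ρ τ s * n := by
  classical
  rw [← ENNReal.tsum_fiberwise _ X.src, colorMass, ← ENNReal.tsum_mul_right]
  refine tsum_congr fun v => ?_
  by_cases hv : v ∈ τ ⁻¹' {s}
  · have hv' : τ v = s := hv
    calc ∑' e : X.src ⁻¹' {v}, ρ (X.src e) * (X.edgesBetween τ s t).indicator 1 (e : X.E)
        = ∑' e, ρ v * {e | X.src e = v ∧ τ (X.tgt e) = t}.indicator 1 e := by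
          rw [tsum_subtype (X.src ⁻¹' {v}) fun e =>
            ρ (X.src e) * (X.edgesBetween τ s t).indicator 1 e]
          refine tsum_congr fun e => ?_
          by_cases he : X.src e = v <;> simp [Set.indicator_apply, edgesBetween, he, hv']
      _ = ρ v * n := by
          simp only [ENNReal.tsum_mul_left, ← tsum_subtype, Pi.one_apply, ENNReal.tsum_set_one,
            h v hv, ENat.toENNReal_coe]
      _ = (τ ⁻¹' {s}).indicator ρ v * n := by rw [Set.indicator_of_mem hv]
  · rw [Set.indicator_of_notMem hv, zero_mul]
    refine ENNReal.tsum_eq_zero.mpr fun ⟨e, he⟩ => ?_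
    rw [Set.indicator_of_notMem fun hmem => hv ((congrArg τ he).symm.trans hmem.1), mul_zero]

theorem HasEdgeCount.colorMass_mul_eq {τ : X.V → K} {s t : K} {m n : ℕ} {Γ : Subgroup X.Aut}
    (hst : HasEdgeCount X τ s t n) (hts : HasEdgeCount X τ t s m)
    (hτ : ∀ (γ : Γ) v, τ (γ • v) = τ v) {ρ : X.V → ℝ≥0∞} (hρ : IsFundamentalDensity Γ ρ) :
    colorMass ρ τ s * n = colorMass ρ τ t * m := by
  classical
  have hinv (γ : Γ) (e : X.E) : (X.edgesBetween τ s t).indicator (1 : X.E → ℝ≥0∞) (γ • e) =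
      (X.edgesBetween τ s t).indicator 1 e := by
    have hsrc : τ (X.src (γ • e)) = τ (X.src e) := (congrArg τ (src_smul γ.1 e)).trans (hτ γ _)
    have htgt : τ (X.tgt (γ • e)) = τ (X.tgt e) := (congrArg τ (tgt_smul γ.1 e)).trans (hτ γ _)
    simp [Set.indicator_apply, edgesBetween, hsrc, htgt]
  rw [← hst.tsum_src_mul_indicator, ← hts.tsum_src_mul_indicator]
  calc ∑' e, ρ (X.src e) * (X.edgesBetween τ s t).indicator 1 e
      = ∑' e, ρ (X.tgt e) * (X.edgesBetween τ s t).indicator 1 e :=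
        (hρ.comp fun γ e => src_smul γ.1 e).tsum_mul_eq (hρ.comp fun γ e => tgt_smul γ.1 e) hinv
    _ = ∑' e, ρ (X.src e) * (X.edgesBetween τ t s).indicator 1 e := by
        have hinvol : Function.Involutive X.inv := X.inv_inv
        rw [← hinvol.toPerm.tsum_eq]
        refine tsum_congr fun e => ?_
        simp [tgt, X.inv_inv, Set.indicator_apply, edgesBetween, and_comm]

/-- Kolmogorov's cycle criterion for reversibility. The masses of the colours with respect to the
action form a reversible measure, which exists only if the products of the edge counts along the two
orientations of a cycle of colours agree. -/
theorem HasEdgeCount.cycle_criterion {τ : X.V → K} {Γ : Subgroup X.Aut} (hp : ActsProperly Γ)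
    (hc : ActsCocompactly Γ) (hτ : ∀ (γ : Γ) v, τ (γ • v) = τ v) {r s t : K}
    {nrs nsr nst nts ntr nrt : ℕ} (hr : ∃ v, τ v = r)
    (hrs : HasEdgeCount X τ r s nrs) (hsr : HasEdgeCount X τ s r nsr)
    (hst : HasEdgeCount X τ s t nst) (hts : HasEdgeCount X τ t s nts)
    (htr : HasEdgeCount X τ t r ntr) (hrt : HasEdgeCount X τ r t nrt) :
    nrs * nst * ntr = nrt * nts * nsr := by
  have := hc.1
  obtain ⟨ρ, hρ, hfin⟩ := exists_isFundamentalDensity (G := Γ) hp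
  let mass : K → ℝ≥0∞ := colorMass ρ τ
  have hmass_ne_top : mass r ≠ ∞ :=
    ne_top_of_le_ne_top hfin (ENNReal.tsum_le_tsum fun v => Set.indicator_le_self _ _ v)
  have hmass_ne_zero : mass r ≠ 0 := by
    obtain ⟨v, hv⟩ := hr
    obtain ⟨γ, hγ⟩ := hρ.exists_smul_ne_zero v
    have hmem : γ • v ∈ τ ⁻¹' {r} := (hτ γ v).trans hv
    intro hzero
    exact hγ ((Set.indicator_of_mem hmem ρ).symm.trans (ENNReal.tsum_eq_zero.mp hzero _))
  have hmass : mass r * (nrs * nst * ntr) = mass r * (nrt * nts * nsr) := by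
    calc mass r * (nrs * nst * ntr) = mass r * nrs * nst * ntr := by ring
      _ = mass s * nst * ntr * nsr := by rw [hrs.colorMass_mul_eq hsr hτ hρ]; ring
      _ = mass t * ntr * nts * nsr := by rw [hst.colorMass_mul_eq hts hτ hρ]; ring
      _ = mass r * (nrt * nts * nsr) := by rw [htr.colorMass_mul_eq hrt hτ hρ]; ring
  exact_mod_cast (ENNReal.mul_right_inj hmass_ne_zero hmass_ne_top).mp hmass

end EdgeCount

/-! ### Twisted products -/

/-- Vertices of a twisted product. -/
inductive TwistVertex (V F : Type) : Type
  | core (v : V) (f : F)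
  | hub (v : V) (f : F)

/-- Oriented edges of a twisted product. -/
inductive TwistEdge (V E F : Type) : Type
  | link (e : E) (f : F)
  | spoke (v : V) (f : F) (s : Fin 3) (b : Bool)

open TwistVertex TwistEdge

/-- The translation along a spoke of a hub whose vertex has twist `a`. -/
def spokeShift {M : Type*} [Zero M] (a : M) (s : Fin 3) : M := if s = 0 then 0 else a

theorem map_spokeShift {M N : Type*} [AddZeroClass M] [AddZeroClass N] (φ : M →+ N) (a : M)
    (s : Fin 3) : φ (spokeShift a s) = spokeShift (φ a) s := by
  simp only [spokeShift, apply_ite φ, map_zero]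

theorem spokeShift_comp_of_injective {M : Type*} [AddZeroClass M] {a : M} {σ : Fin 3 → Fin 3}
    (hσ : Function.Injective σ) (h : spokeShift a (σ 1) = spokeShift a (σ 2)) :
    spokeShift a (σ 1) = spokeShift a (σ 0) + a := by
  have h01 := hσ.ne (show (0 : Fin 3) ≠ 1 by decide)
  have h02 := hσ.ne (show (0 : Fin 3) ≠ 2 by decide)
  have h12 := hσ.ne (show (1 : Fin 3) ≠ 2 by decide)
  unfold spokeShift at h ⊢
  split_ifs at h ⊢ <;> first | omega | simp [← h] | simp_all

/-- The colouring of a twisted product by the colours of the underlying vertices; the hubs get a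
colour of their own. -/
def twistColor {V F : Type} {K : Type*} (τ : V → K) : TwistVertex V F → Option K
  | core v _ => some (τ v)
  | hub _ _ => none

section Twist

variable {F F' : Type} [AddCommGroup F] [AddCommGroup F']

/-- The twisted product of `Y` with `F`: the product of `Y` with the set `F`, in which every
`(v, f)` is joined to `(v, f + α v)` through a hub, which has one edge to the former and two edges
to the latter. -/
abbrev twist (Y : SerreGraph) (α : Y.V → F) : SerreGraph where
  V := TwistVertex Y.V F
  E := TwistEdge Y.V Y.E F
  src
    | link e f => core (Y.src e) f
    | spoke v f s true => core v (f + spokeShift (α v) s)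
    | spoke v f _ false => hub v f
  inv
    | link e f => link (Y.inv e) f
    | spoke v f s b => spoke v f s (!b)
  inv_inv
    | link e f => by simp [Y.inv_inv]
    | spoke v f s b => by simp
  inv_ne
    | link e f => by simp [Y.inv_ne]
    | spoke v f s b => by simp

variable {Y Y' : SerreGraph} {α : Y.V → F} {α' : Y'.V → F'}

theorem twist_starAt_core (v : Y.V) (f : F) :
    (twist Y α).starAt (core v f) = (link · f) '' Y.starAt v ∪
      Set.range fun s => spoke v (f - spokeShift (α v) s) s true := by
  ext e
  constructor
  · intro he
    rcases e with ⟨e, f'⟩ | ⟨w, f', s, _ | _⟩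
    · obtain ⟨rfl, rfl⟩ := TwistVertex.core.inj he
      exact .inl ⟨e, rfl, rfl⟩
    · cases he
    · obtain ⟨rfl, rfl⟩ := TwistVertex.core.inj he
      exact .inr ⟨s, by simp only [add_sub_cancel_right]⟩
  · rintro (⟨e, rfl, rfl⟩ | ⟨s, rfl⟩)
    · rfl
    · exact congrArg (core v) (sub_add_cancel _ _)

theorem twist_starAt_hub (v : Y.V) (f : F) :
    (twist Y α).starAt (hub v f) = Set.range fun s => spoke v f s false := by
  ext e
  constructor
  · intro he
    rcases e with ⟨e, f'⟩ | ⟨w, f', s, _ | _⟩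
    · cases he
    · obtain ⟨rfl, rfl⟩ := TwistVertex.hub.inj he
      exact ⟨s, rfl⟩
    · cases he
  · rintro ⟨s, rfl⟩
    rfl

theorem twist_src_eq_core {e : (twist Y α).E} {v : Y.V} {f : F}
    (h : (twist Y α).src e = core v f) :
    (∃ e', Y.src e' = v ∧ link e' f = e) ∨
      ∃ s, spoke v (f - spokeShift (α v) s) s true = e :=
  (twist_starAt_core v f).subset h

theorem twist_src_eq_hub {e : (twist Y α).E} {v : Y.V} {f : F}
    (h : (twist Y α).src e = hub v f) : ∃ s, spoke v f s false = e :=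
  (twist_starAt_hub v f).subset h

/-- The morphism of twisted products induced by a morphism and a homomorphism. -/
def twistMap (h : Hom Y Y') (φ : F →+ F') (hα : ∀ v, α' (h.onV v) = φ (α v)) :
    Hom (twist Y α) (twist Y' α') where
  onV
    | core v f => core (h.onV v) (φ f)
    | hub v f => hub (h.onV v) (φ f)
  onE
    | link e f => link (h.onE e) (φ f)
    | spoke v f s b => spoke (h.onV v) (φ f) s b
  src_onE
    | link e f => congrArg (core · (φ f)) (h.src_onE e)
    | spoke v f s true => congrArg (core (h.onV v)) (by rw [map_add, map_spokeShift, hα])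
    | spoke v f _ false => rfl
  inv_onE
    | link e f => congrArg (link · (φ f)) (h.inv_onE e)
    | spoke v f s b => rfl

theorem twistMap_isCovering {h : Hom Y Y'} (hh : h.IsCovering) {φ : F →+ F'}
    (hφ : Function.Surjective φ) (hα : ∀ v, α' (h.onV v) = φ (α v)) :
    (twistMap h φ hα).IsCovering := by
  refine Hom.isCovering_of_exists_lift ?_ ?_ ?_
  · rintro (⟨v, f⟩ | ⟨v, f⟩) <;> obtain ⟨v, rfl⟩ := hh.1 v <;> obtain ⟨f, rfl⟩ := hφ f
    · exact ⟨core v f, rfl⟩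
    · exact ⟨hub v f, rfl⟩
  · intro e e' hsrc hee'
    rcases hx : (twist Y α).src e' with ⟨v, f⟩ | ⟨v, f⟩ <;> rw [hx] at hsrc
    · rcases twist_src_eq_core hsrc with ⟨e, he, rfl⟩ | ⟨s, rfl⟩ <;>
        rcases twist_src_eq_core hx with ⟨e', he', rfl⟩ | ⟨s', rfl⟩
      · rw [(hh.2 v).injOn he he' (TwistEdge.link.inj hee').1]
      · cases hee'
      · cases hee'
      · obtain rfl := (TwistEdge.spoke.inj hee').2.2.1
        rfl
    · obtain ⟨s, rfl⟩ := twist_src_eq_hub hsrc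
      obtain ⟨s', rfl⟩ := twist_src_eq_hub hx
      obtain rfl := (TwistEdge.spoke.inj hee').2.2.1
      rfl
  · rintro (⟨v, f⟩ | ⟨v, f⟩) e' he'
    · rcases twist_src_eq_core he' with ⟨e', hsrc, rfl⟩ | ⟨s, rfl⟩
      · obtain ⟨e, rfl, rfl⟩ := hh.exists_lift hsrc
        exact ⟨link e f, rfl, rfl⟩
      · refine ⟨spoke v (f - spokeShift (α v) s) s true, congrArg (core v) (sub_add_cancel _ _), ?_⟩
        exact congrArg (spoke (h.onV v) · s true) (by rw [map_sub, map_spokeShift, hα])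
    · obtain ⟨s, rfl⟩ := twist_src_eq_hub he'
      exact ⟨spoke v f s false, rfl, rfl⟩

theorem twistMap_onV_injective {h : Hom Y Y'} (hh : Function.Injective h.onV) {φ : F →+ F'}
    (hφ : Function.Injective φ) (hα : ∀ v, α' (h.onV v) = φ (α v)) :
    Function.Injective (twistMap h φ hα).onV := by
  rintro (⟨v, x⟩ | ⟨v, x⟩) (⟨w, y⟩ | ⟨w, y⟩) heq
  · obtain ⟨hv, hx⟩ := TwistVertex.core.inj heq
    rw [hh hv, hφ hx]
  · cases heq
  · cases heq
  · obtain ⟨hv, hx⟩ := TwistVertex.hub.inj heq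
    rw [hh hv, hφ hx]

theorem twist_isFinite (hY : Y.IsFinite) [Finite F] : (twist Y α).IsFinite := by
  have := hY.1
  have := hY.2
  constructor
  · refine Finite.of_surjective
      (Sum.elim (fun p : Y.V × F => core p.1 p.2) fun p : Y.V × F => hub p.1 p.2) ?_
    rintro (⟨v, f⟩ | ⟨v, f⟩)
    · exact ⟨.inl (v, f), rfl⟩
    · exact ⟨.inr (v, f), rfl⟩
  · refine Finite.of_surjective (Sum.elim (fun p : Y.E × F => link p.1 p.2)
      fun p : Y.V × F × Fin 3 × Bool => spoke p.1 p.2.1 p.2.2.1 p.2.2.2) ?_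
    rintro (⟨e, f⟩ | ⟨v, f, s, b⟩)
    · exact ⟨.inl (e, f), rfl⟩
    · exact ⟨.inr (v, f, s, b), rfl⟩

theorem twist_locallyFinite (hY : Y.LocallyFinite) : (twist Y α).LocallyFinite := by
  rintro (⟨v, f⟩ | ⟨v, f⟩)
  · rw [twist_starAt_core]
    exact ((hY v).image _).union (Set.finite_range _)
  · rw [twist_starAt_hub]
    exact Set.finite_range _

theorem HasEdgeCount.twist {K : Type*} {τ : Y.V → K} {s t : K} {n : ℕ}
    (h : HasEdgeCount Y τ s t n) :
    HasEdgeCount (twist Y α) (twistColor τ) (some s) (some t) n := by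
  rintro (⟨v, f⟩ | ⟨v, f⟩) hv
  · rw [← h v (Option.some.inj hv),
      ← (show Function.Injective fun e : Y.E => (link e f : (SerreGraph.twist Y α).E) from
        fun _ _ h => (TwistEdge.link.inj h).1).encard_image]
    congr 1
    ext e
    constructor
    · rintro ⟨hsrc, htgt⟩
      rcases twist_src_eq_core hsrc with ⟨e, he, rfl⟩ | ⟨s, rfl⟩
      · exact ⟨e, ⟨he, Option.some.inj htgt⟩, rfl⟩
      · cases htgt
    · rintro ⟨e, ⟨rfl, rfl⟩, rfl⟩
      exact ⟨rfl, rfl⟩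
  · cases hv

/-! ### Rigidity of coverings between twisted products -/

theorem encard_starAt_hub (v : Y.V) (f : F) : ((twist Y α).starAt (hub v f)).encard = 3 := by
  rw [twist_starAt_hub, ← Set.image_univ, Function.Injective.encard_image]
  · simp
  · exact fun s s' h => (TwistEdge.spoke.inj h).2.2.1

theorem encard_starAt_core (v : Y.V) (f : F) :
    ((twist Y α).starAt (core v f)).encard = (Y.starAt v).encard + 3 := by
  rw [twist_starAt_core, Set.encard_union_eq, Function.Injective.encard_image, ← Set.image_univ,
    Function.Injective.encard_image]
  · simp
  · exact fun s s' h => (TwistEdge.spoke.inj h).2.2.1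
  · exact fun e e' h => (TwistEdge.link.inj h).1
  · rw [Set.disjoint_left]
    rintro _ ⟨e, -, rfl⟩ ⟨s, hs⟩
    cases hs

theorem encard_starAt_core_ne (v : Y.V) (f : F) (hY : (Y.starAt v).Nonempty) :
    ((twist Y α).starAt (core v f)).encard ≠ 3 := by
  rw [encard_starAt_core]
  intro h
  have hzero : (Y.starAt v).encard = 0 :=
    WithTop.add_right_cancel (ENat.natCast_ne_top 3) (h.trans (zero_add 3).symm)
  exact hY.ne_empty (Set.encard_eq_zero.mp hzero)

section Covering

variable {ψ : Hom (twist Y α) (twist Y' α')}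

theorem Hom.IsCovering.exists_onV_core (hψ : ψ.IsCovering) (hY : ∀ v, (Y.starAt v).Nonempty)
    (v : Y.V) (f : F) : ∃ u i, ψ.onV (core v f) = core u i := by
  rcases h : ψ.onV (core v f) with ⟨u, i⟩ | ⟨u, i⟩
  · exact ⟨u, i, rfl⟩
  · have hcard := hψ.encard_starAt (core v f)
    rw [h, encard_starAt_hub] at hcard
    exact absurd hcard.symm (encard_starAt_core_ne v f (hY v))

theorem Hom.IsCovering.exists_onV_hub (hψ : ψ.IsCovering) (hY' : ∀ u, (Y'.starAt u).Nonempty)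
    (v : Y.V) (f : F) : ∃ u i, ψ.onV (hub v f) = hub u i := by
  rcases h : ψ.onV (hub v f) with ⟨u, i⟩ | ⟨u, i⟩
  · have hcard := hψ.encard_starAt (hub v f)
    rw [h, encard_starAt_hub] at hcard
    exact absurd hcard (encard_starAt_core_ne u i (hY' u))
  · exact ⟨u, i, rfl⟩

theorem Hom.IsCovering.exists_lift_link (hψ : ψ.IsCovering) (hY' : ∀ u, (Y'.starAt u).Nonempty)
    {v : Y.V} {f : F} {e' : Y'.E} {i : F'} (h : ψ.onV (core v f) = core (Y'.src e') i) :
    ∃ e, Y.src e = v ∧ ψ.onV (core (Y.tgt e) f) = core (Y'.tgt e') i := by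
  obtain ⟨e, he, hee'⟩ := hψ.exists_lift (e' := link e' i) h.symm
  have htgt : ψ.onV ((twist Y α).tgt e) = core (Y'.tgt e') i := by
    rw [← ψ.tgt_onE, hee']
    rfl
  rcases twist_src_eq_core he with ⟨e, hsrc, rfl⟩ | ⟨s, rfl⟩
  · exact ⟨e, hsrc, htgt⟩
  · obtain ⟨u, j, hu⟩ := hψ.exists_onV_hub hY' v (f - spokeShift (α v) s)
    cases hu.symm.trans htgt

/-- The spokes at a hub recognize the vertex with two of them, hence the direction of the twist. -/
theorem Hom.IsCovering.onV_core_add (hψ : ψ.IsCovering) (hY' : ∀ u, (Y'.starAt u).Nonempty)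
    {v : Y.V} {f : F} {u : Y'.V} {i : F'} (h : ψ.onV (core v f) = core u i) :
    ψ.onV (core v (f + α v)) = core u (i + α' u) := by
  obtain ⟨w, j, hw⟩ := hψ.exists_onV_hub hY' v f
  have hspoke (s : Fin 3) : ∃ r, spoke w j r false = ψ.onE (spoke v f s false) :=
    twist_src_eq_hub ((ψ.src_onE _).trans hw)
  choose σ hσ using hspoke
  have hσ_inj : Function.Injective σ := fun s s' hss => by
    have := (hψ.2 (hub v f)).injOn (x₁ := spoke v f s false) (x₂ := spoke v f s' false) rfl rfl
      (by rw [← hσ s, ← hσ s', hss])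
    exact (TwistEdge.spoke.inj this).2.2.1
  have hend (s : Fin 3) : ψ.onV (core v (f + spokeShift (α v) s)) =
      core w (j + spokeShift (α' w) (σ s)) :=
    (ψ.tgt_onE (spoke v f s false)).symm.trans (by rw [← hσ]; rfl)
  have hend₀ := hend 0
  rw [show spokeShift (α v) 0 = 0 from rfl, add_zero, h] at hend₀
  obtain ⟨rfl, rfl⟩ := TwistVertex.core.inj hend₀
  have hdouble := TwistVertex.core.inj ((hend 1).symm.trans (hend 2))
  rw [add_assoc, ← spokeShift_comp_of_injective hσ_inj (add_left_cancel hdouble.2)]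
  exact hend 1

theorem Hom.IsCovering.onV_core_add_nsmul (hψ : ψ.IsCovering) (hY' : ∀ u, (Y'.starAt u).Nonempty)
    {v : Y.V} {f : F} {u : Y'.V} {i : F'} (h : ψ.onV (core v f) = core u i) (n : ℕ) :
    ψ.onV (core v (f + n • α v)) = core u (i + n • α' u) := by
  induction n with
  | zero => simpa using h
  | succ n ih =>
    rw [succ_nsmul, succ_nsmul, ← add_assoc, ← add_assoc]
    exact hψ.onV_core_add hY' ih

theorem Hom.IsCovering.addOrderOf_dvd (hψ : ψ.IsCovering) (hY' : ∀ u, (Y'.starAt u).Nonempty)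
    {v : Y.V} {f : F} {u : Y'.V} {i : F'} (h : ψ.onV (core v f) = core u i) :
    addOrderOf (α' u) ∣ addOrderOf (α v) := by
  have hadd := hψ.onV_core_add_nsmul hY' h (addOrderOf (α v))
  rw [addOrderOf_nsmul_eq_zero, add_zero, h] at hadd
  exact addOrderOf_dvd_of_nsmul_eq_zero (left_eq_add.mp (TwistVertex.core.inj hadd).2)

/-- The orders of the twists give one direction. For the other, take a vertex `w` outside `S` whose
only neighbour in `S` is `v`. The image of `w` is outside `S'`, and the edge from there to `S'`
lifts to an edge from `w` to `S`, hence to `v`. -/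
theorem Hom.IsCovering.onV_core_mem_iff (hψ : ψ.IsCovering) (hY : ∀ v, (Y.starAt v).Nonempty)
    (hY' : ∀ u, (Y'.starAt u).Nonempty) {S : Set Y.V} {S' : Set Y'.V}
    (hord : ∀ v ∉ S, ∀ u ∈ S', ¬ addOrderOf (α' u) ∣ addOrderOf (α v))
    (hS' : ∀ u ∉ S', ∃ e, Y'.src e = u ∧ Y'.tgt e ∈ S')
    (hS : ∀ v ∈ S, ∃ w ∉ S, ∀ e, Y.src e = w → Y.tgt e ∈ S → Y.tgt e = v)
    {v : Y.V} {f : F} {u : Y'.V} {i : F'} (h : ψ.onV (core v f) = core u i) :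
    u ∈ S' ↔ v ∈ S := by
  have mem_of_mem {v : Y.V} {f : F} {u : Y'.V} {i : F'} (h : ψ.onV (core v f) = core u i)
      (hu : u ∈ S') : v ∈ S :=
    not_imp_comm.mp (hord v) fun hv => hv u hu (hψ.addOrderOf_dvd hY' h)
  refine ⟨mem_of_mem h, fun hv => ?_⟩
  obtain ⟨w, hw, huniq⟩ := hS v hv
  obtain ⟨x, j, hx⟩ := hψ.exists_onV_core hY w f
  obtain ⟨e', rfl, he'⟩ := hS' x fun hxS => hw (mem_of_mem hx hxS)
  obtain ⟨e, he, htgt⟩ := hψ.exists_lift_link hY' hx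
  rw [huniq e he (mem_of_mem htgt he'), h] at htgt
  rwa [(TwistVertex.core.inj htgt).1]

end Covering

end Twist

/-! ### Graphs given by an involution of ports -/

section OfPorts

variable {V P V' P' : Type} {ι : V × P → V × P} {ι' : V' × P' → V' × P'}

/-- The graph in which every vertex `v` has two oriented edges for each port `p`, which lead to the
vertex of the port `ι (v, p)`. The fixed points of `ι` give loops, all other ports give double
edges. -/
abbrev ofPorts (ι : V × P → V × P) (hι : Function.Involutive ι) : SerreGraph where
  V := V
  E := (V × P) × Bool
  src e := e.1.1
  inv e := (ι e.1, !e.2)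
  inv_inv e := by simp [hι e.1]
  inv_ne e := by simp [Prod.ext_iff]

variable {hι : Function.Involutive ι} {hι' : Function.Involutive ι'}

theorem ofPorts_starAt (v : V) :
    (ofPorts ι hι).starAt v = Set.range fun p : P × Bool => ((v, p.1), p.2) := by
  ext ⟨⟨w, p⟩, j⟩
  constructor
  · rintro rfl
    exact ⟨(p, j), rfl⟩
  · rintro ⟨q, h⟩
    exact congrArg (·.1.1) h.symm

theorem ofPorts_starAt_nonempty [Nonempty P] (v : V) : ((ofPorts ι hι).starAt v).Nonempty := by
  rw [ofPorts_starAt]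
  exact Set.range_nonempty _

theorem ofPorts_isFinite [Finite V] [Finite P] : (ofPorts ι hι).IsFinite :=
  ⟨inferInstanceAs (Finite V), inferInstanceAs (Finite ((V × P) × Bool))⟩

theorem ofPorts_locallyFinite [Finite P] : (ofPorts ι hι).LocallyFinite := fun v => by
  rw [ofPorts_starAt]
  exact Set.finite_range _

theorem ofPorts_hasEdgeCount {K : Type*} {τ : V → K} {s t : K} {n : ℕ}
    (h : ∀ v, τ v = s → {p | τ (ι (v, p)).1 = t}.encard = n) :
    HasEdgeCount (ofPorts ι hι) τ s t (2 * n) := by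
  intro v hv
  have himage : {e | (ofPorts ι hι).src e = v ∧ τ ((ofPorts ι hι).tgt e) = t} =
      (fun p : P × Bool => ((v, p.1), p.2)) '' ({p | τ (ι (v, p)).1 = t} ×ˢ Set.univ) := by
    ext ⟨⟨w, p⟩, j⟩
    constructor
    · rintro ⟨rfl, ht⟩
      exact ⟨(p, j), ⟨ht, trivial⟩, rfl⟩
    · rintro ⟨⟨p, j⟩, ⟨ht, -⟩, h⟩
      cases h
      exact ⟨rfl, ht⟩
  have hinj : Function.Injective fun p : P × Bool => ((v, p.1), p.2) := fun p q h => by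
    simpa [Prod.ext_iff] using h
  rw [himage, hinj.encard_image, Set.encard_prod, h v hv, Set.encard_univ]
  simp [mul_comm]

/-- The morphism induced by maps of vertices and of ports. -/
def ofPortsMap (f : V → V') (π : V → P → P')
    (h : ∀ v p, ι' (f v, π v p) = (f (ι (v, p)).1, π (ι (v, p)).1 (ι (v, p)).2)) :
    Hom (ofPorts ι hι) (ofPorts ι' hι') where
  onV := f
  onE e := ((f e.1.1, π e.1.1 e.1.2), e.2)
  src_onE _ := rfl
  inv_onE e := Prod.ext (h e.1.1 e.1.2) rfl

theorem ofPortsMap_isCovering {f : V → V'} {π : V → P → P'}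
    (h : ∀ v p, ι' (f v, π v p) = (f (ι (v, p)).1, π (ι (v, p)).1 (ι (v, p)).2))
    (hf : Function.Surjective f) (hπ : ∀ v, Function.Bijective (π v)) :
    (ofPortsMap (hι := hι) (hι' := hι') f π h).IsCovering := by
  refine Hom.isCovering_of_exists_lift hf ?_ ?_
  · rintro ⟨⟨v, p⟩, j⟩ ⟨⟨w, q⟩, k⟩ (rfl : v = w) heq
    obtain ⟨hport, hbool⟩ := Prod.ext_iff.mp heq
    exact Prod.ext (Prod.ext rfl ((hπ v).1 (Prod.ext_iff.mp hport).2)) hbool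
  · rintro v ⟨⟨w, q⟩, j⟩ (rfl : w = f v)
    obtain ⟨p, rfl⟩ := (hπ v).2 q
    exact ⟨((v, p), j), rfl, rfl⟩

end OfPorts

/-! ### The binary tree with a fixed end -/

/-- The vertices of the binary tree with a fixed end: a level, and the finitely many nonzero binary
digits that describe the way from the end. -/
abbrev Node : Type := ℤ × ℕ

namespace Node

/-- The neighbour in the direction of the fixed end. -/
def parent (ν : Node) : Node := (ν.1 - 1, ν.2.div2)

/-- The two neighbours away from the fixed end. -/
def child (x : Bool) (ν : Node) : Node := (ν.1 + 1, Nat.bit x ν.2)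

/-- The index of a node among the children of its parent. -/
def digit (ν : Node) : Bool := ν.2.bodd

@[simp] theorem parent_child (x : Bool) (ν : Node) : parent (child x ν) = ν := by
  simp [parent, child, Nat.div2_bit]

@[simp] theorem digit_child (x : Bool) (ν : Node) : digit (child x ν) = x := by
  simp [digit, child]

@[simp] theorem child_digit_parent (ν : Node) : child (digit ν) (parent ν) = ν := by
  simp [parent, child, digit, Nat.bit_bodd_div2]

/-- The sum of the binary digits modulo three. -/
def digitSum : ℕ → ZMod 3 := Nat.binaryRec 0 fun x _ s => s + if x then 1 else 0

theorem digitSum_bit (x : Bool) (k : ℕ) :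
    digitSum (Nat.bit x k) = digitSum k + if x then 1 else 0 :=
  Nat.binaryRec_eq x k (.inl rfl)

/-- A colour in `ℤ/3` for which the colours of a node and of its two children are distinct. -/
def color (ν : Node) : ZMod 3 := ν.1 + digitSum ν.2

/-- The difference between the colours of a child and of its parent. -/
def colorShift (x : Bool) : ZMod 3 := if x then 2 else 1

theorem color_child (x : Bool) (ν : Node) : color (child x ν) = color ν + colorShift x := by
  have htwo : (2 : ZMod 3) = 1 + 1 := rfl
  cases x <;> simp only [color, colorShift, child, digitSum_bit, Int.cast_add, Int.cast_one,
    htwo, if_true, Bool.false_eq_true, if_false] <;> ring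

/-- The parity of the level. -/
def parity (ν : Node) : Bool := ν.1.bodd

theorem parity_child (x : Bool) (ν : Node) : parity (child x ν) = !parity ν := by
  simp [parity, child, Int.bodd_add]

end Node

open Node

/-! ### The three untwisted graphs -/

/-- The three kinds of vertices of the base graph. -/
inductive Letter : Type
  | a | b | c
  deriving DecidableEq

instance : Finite Letter :=
  Finite.of_surjective ![Letter.a, .b, .c] <| by
    rintro (_ | _ | _)
    exacts [⟨0, rfl⟩, ⟨1, rfl⟩, ⟨2, rfl⟩]

/-- The ports of the base graph: over each node `ν` there are vertices `a`, `b` and `c`; the vertex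
`a` is joined to `b` and `c`, and `b` is joined to the vertices `c` over the children of `ν`. -/
def basePort : (Node × Letter) × Option Bool → (Node × Letter) × Option Bool
  | ((ν, .a), none) => ((ν, .a), none)
  | ((ν, .a), some false) => ((ν, .b), none)
  | ((ν, .a), some true) => ((ν, .c), none)
  | ((ν, .b), none) => ((ν, .a), some false)
  | ((ν, .b), some x) => ((child x ν, .c), some x)
  | ((ν, .c), none) => ((ν, .a), some true)
  | ((ν, .c), some x) => if x = digit ν then ((parent ν, .b), some x) else ((ν, .c), some x)

theorem basePort_involutive : Function.Involutive basePort := by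
  rintro ⟨⟨ν, _ | _ | _⟩, _ | _ | _⟩
  all_goals simp only [basePort, digit_child, if_true, parent_child]
  all_goals
    split_ifs with h
    · simp only [h, child_digit_parent]
    · simp only [h, if_false]

/-- The base graph. -/
abbrev base : SerreGraph := ofPorts basePort basePort_involutive

/-- The ports of a finite quotient of the base graph that separates the vertices `a`, here `none`,
from `b` and `c`, which become two vertices with isomorphic neighbourhoods. -/
def leftPort : Option Bool × Option Bool → Option Bool × Option Bool
  | (none, none) => (none, none)
  | (none, some i) => (some i, none)
  | (some i, none) => (none, some i)
  | (some i, some x) => (some i, some x)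

theorem leftPort_involutive : Function.Involutive leftPort := by
  rintro ⟨_ | _, _ | _⟩ <;> rfl

/-- The quotient of the base graph that separates the vertices `a` from `b` and `c`. -/
abbrev left : SerreGraph := ofPorts leftPort leftPort_involutive

/-- The ports of a finite quotient of the base graph that separates the vertices `b`, here `none`,
from `a` and `c`, which become three vertices with isomorphic neighbourhoods. -/
def rightPort : Option (ZMod 3) × ZMod 3 → Option (ZMod 3) × ZMod 3
  | (none, i) => (some i, 0)
  | (some i, r) => if r = 0 then (none, i) else (some i, r)

theorem rightPort_involutive : Function.Involutive rightPort := by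
  rintro ⟨_ | i, r⟩
  · simp [rightPort]
  · by_cases h : r = 0 <;> simp [rightPort, h]

/-- The quotient of the base graph that separates the vertices `b` from `a` and `c`. -/
abbrev right : SerreGraph := ofPorts rightPort rightPort_involutive

/-- The covering of `left` on vertices. -/
def leftVertex : Node × Letter → Option Bool
  | (_, .a) => none
  | (ν, .b) => some (parity ν)
  | (ν, .c) => some !(parity ν)

/-- The covering of `left` on ports. -/
def leftMap : Node × Letter → Option Bool → Option Bool
  | (ν, .a), some x => some (xor x (parity ν))
  | _, p => p

theorem leftPort_map (v : Node × Letter) (p : Option Bool) :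
    leftPort (leftVertex v, leftMap v p) =
      (leftVertex (basePort (v, p)).1, leftMap (basePort (v, p)).1 (basePort (v, p)).2) := by
  rcases v with ⟨ν, _ | _ | _⟩ <;> rcases p with _ | x
  · rfl
  · cases x <;> simp [leftPort, leftVertex, leftMap, basePort]
  · simp [leftPort, leftVertex, leftMap, basePort]
  · simp [leftPort, leftVertex, leftMap, basePort, parity_child]
  · simp [leftPort, leftVertex, leftMap, basePort]
  · obtain ⟨y, ν, rfl⟩ : ∃ y μ, ν = child y μ := ⟨_, _, (child_digit_parent ν).symm⟩
    by_cases h : x = y <;> simp [leftPort, leftVertex, leftMap, basePort, h, parity_child]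

/-- The covering of `left` by the base graph. -/
def baseToLeft : Hom base left := ofPortsMap leftVertex leftMap leftPort_map

theorem baseToLeft_isCovering : baseToLeft.IsCovering := by
  refine ofPortsMap_isCovering leftPort_map ?_ ?_
  · rintro (_ | _ | _)
    exacts [⟨((0, 0), .a), rfl⟩, ⟨((0, 0), .b), rfl⟩, ⟨((0, 0), .c), rfl⟩]
  · rintro ⟨ν, _ | _ | _⟩
    · refine Function.Involutive.bijective ?_
      rintro (_ | x) <;> simp [leftMap]
    · exact Function.bijective_id
    · exact Function.bijective_id

/-- The covering of `right` on vertices. -/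
def rightVertex : Node × Letter → Option (ZMod 3)
  | (_, .b) => none
  | (ν, _) => some (color ν)

/-- The covering of `right` on ports. -/
def rightMap : Node × Letter → Option Bool → ZMod 3
  | (_, .a), p => p.elim 2 fun x => if x then 1 else 0
  | (ν, .b), p => p.elim (color ν) fun x => color ν + colorShift x
  | (ν, .c), p => p.elim 1 fun x => if x = digit ν then 0 else 2

theorem rightMap_bijective (v : Node × Letter) : Function.Bijective (rightMap v) := by
  rcases v with ⟨ν, _ | _ | _⟩
  · exact (by decide :
      Function.Bijective fun p : Option Bool => p.elim (2 : ZMod 3) fun x => if x then 1 else 0)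
  · exact (by decide : ∀ i : ZMod 3,
      Function.Bijective fun p : Option Bool => p.elim i fun x => i + colorShift x) (color ν)
  · exact (by decide : ∀ y : Bool, Function.Bijective fun p : Option Bool =>
      p.elim (1 : ZMod 3) fun x => if x = y then 0 else 2) (digit ν)

theorem rightPort_map (v : Node × Letter) (p : Option Bool) :
    rightPort (rightVertex v, rightMap v p) =
      (rightVertex (basePort (v, p)).1, rightMap (basePort (v, p)).1 (basePort (v, p)).2) := by
  have htwo : (2 : ZMod 3) ≠ 0 := by decide
  rcases v with ⟨ν, _ | _ | _⟩ <;> rcases p with _ | x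
  · simp [rightPort, rightVertex, rightMap, basePort, htwo]
  · cases x <;> simp [rightPort, rightVertex, rightMap, basePort]
  · simp [rightPort, rightVertex, rightMap, basePort]
  · simp [rightPort, rightVertex, rightMap, basePort, color_child]
  · simp [rightPort, rightVertex, rightMap, basePort]
  · obtain ⟨y, ν, rfl⟩ : ∃ y μ, ν = child y μ := ⟨_, _, (child_digit_parent ν).symm⟩
    by_cases h : x = y <;>
      simp [rightPort, rightVertex, rightMap, basePort, h, color_child, htwo]

/-- The covering of `right` by the base graph. -/
def baseToRight : Hom base right := ofPortsMap rightVertex rightMap rightPort_map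

theorem baseToRight_isCovering : baseToRight.IsCovering := by
  refine ofPortsMap_isCovering rightPort_map ?_ rightMap_bijective
  rintro (_ | i)
  · exact ⟨((0, 0), .b), rfl⟩
  · refine ⟨((i.val, 0), .a), ?_⟩
    simp [rightVertex, color, digitSum]

/-! ### Automorphisms of the quasitree -/

namespace Node

/-- The permutation of the nodes that subtracts `n` from the levels and adds the digits `g`. -/
def translate (n : ℤ) (g : ℤ → ℕ) : Equiv.Perm Node where
  toFun ν := (ν.1 - n, ν.2 ^^^ g ν.1)
  invFun ν := (ν.1 + n, ν.2 ^^^ g (ν.1 + n))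
  left_inv ν := by simp
  right_inv ν := by simp

theorem translate_child (n : ℤ) {g : ℤ → ℕ} (hg : ∀ n, g n = (g (n + 1)).div2) (x : Bool)
    (ν : Node) :
    translate n g (child x ν) = child (xor x (g (ν.1 + 1)).bodd) (translate n g ν) := by
  refine Prod.ext (add_sub_right_comm _ _ _) ?_
  change Nat.bit x ν.2 ^^^ g (ν.1 + 1) = Nat.bit (xor x (g (ν.1 + 1)).bodd) (ν.2 ^^^ g ν.1)
  rw [hg ν.1, ← Nat.xor_bit, Nat.bit_bodd_div2]

theorem exists_digits (n : ℤ) (k : ℕ) : ∃ g : ℤ → ℕ, (∀ n, g n = (g (n + 1)).div2) ∧ g n = k := by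
  refine ⟨fun m => k * 2 ^ (m - n).toNat / 2 ^ (n - m).toNat, fun m => ?_, by simp⟩
  dsimp only
  rw [Nat.div2_val]
  rcases le_or_gt n m with h | h
  · rw [show (m + 1 - n).toNat = (m - n).toNat + 1 by omega,
      show (n - m).toNat = 0 by omega, show (n - (m + 1)).toNat = 0 by omega, pow_succ,
      ← mul_assoc]
    simp
  · rw [show (m + 1 - n).toNat = 0 by omega, show (m - n).toNat = 0 by omega,
      show (n - m).toNat = (n - (m + 1)).toNat + 1 by omega, pow_succ, Nat.div_div_eq_div_mul]

theorem exists_perm_apply_eq_zero (ν : Node) : ∃ (σ : Equiv.Perm Node) (ε : Node → Bool),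
    (∀ x μ, σ (child x μ) = child (xor x (ε μ)) (σ μ)) ∧ σ ν = 0 := by
  obtain ⟨g, hg, hgν⟩ := exists_digits ν.1 ν.2
  exact ⟨translate ν.1 g, _, translate_child ν.1 hg, by simp [translate, hgν]⟩

end Node

section Perm

variable {σ : Equiv.Perm Node} {ε : Node → Bool}

/-- The action on ports of a permutation of the nodes that exchanges the children of `ν` if
`ε ν` holds. -/
def permPort (ε : Node → Bool) : Node × Letter → Option Bool → Option Bool
  | (_, .a), p => p
  | (ν, .b), p => p.map (xor · (ε ν))
  | (ν, .c), p => p.map (xor · (ε (parent ν)))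

theorem basePort_permPort (hσ : ∀ x ν, σ (child x ν) = child (xor x (ε ν)) (σ ν))
    (v : Node × Letter) (p : Option Bool) :
    basePort ((σ v.1, v.2), permPort ε v p) =
      ((σ (basePort (v, p)).1.1, (basePort (v, p)).1.2),
        permPort ε (basePort (v, p)).1 (basePort (v, p)).2) := by
  rcases v with ⟨ν, _ | _ | _⟩ <;> rcases p with _ | x
  · rfl
  · cases x <;> rfl
  · rfl
  · simp [permPort, basePort, hσ]
  · rfl
  · obtain ⟨y, ν, rfl⟩ : ∃ y μ, ν = child y μ := ⟨_, _, (child_digit_parent ν).symm⟩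
    by_cases h : x = y <;> simp [permPort, basePort, hσ, h]

/-- The endomorphism of the base graph induced by a permutation of the nodes. -/
def basePerm (hσ : ∀ x ν, σ (child x ν) = child (xor x (ε ν)) (σ ν)) : Hom base base :=
  ofPortsMap (fun v => (σ v.1, v.2)) (permPort ε) (basePort_permPort hσ)

theorem basePerm_isCovering (hσ : ∀ x ν, σ (child x ν) = child (xor x (ε ν)) (σ ν)) :
    (basePerm hσ).IsCovering := by
  refine ofPortsMap_isCovering _ (σ.surjective.prodMap Function.surjective_id) ?_
  rintro ⟨ν, _ | _ | _⟩
  · exact Function.bijective_id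
  all_goals
    refine Function.Involutive.bijective ?_
    rintro (_ | x) <;> simp [permPort]

end Perm

/-- The twists of the three kinds of vertices. -/
def letterTwist : Letter → ZMod 2 × ZMod 3
  | .a => (1, 0)
  | .b => (0, 1)
  | .c => 0

/-- The quasitree. -/
abbrev quasitree : SerreGraph := twist base fun v => letterTwist v.2

/-- The node below a vertex of the quasitree. -/
def vertexNode : quasitree.V → Node
  | core v _ => v.1
  | hub v _ => v.1

theorem exists_aut_vertexNode_eq_zero (v : quasitree.V) :
    ∃ γ : quasitree.Aut, vertexNode ((autHom γ).onV v) = 0 := by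
  obtain ⟨σ, ε, hσ, hzero⟩ := exists_perm_apply_eq_zero (vertexNode v)
  have hinj : Function.Injective (basePerm hσ).onV := σ.injective.prodMap Function.injective_id
  let f : Hom quasitree quasitree := twistMap (basePerm hσ) (AddMonoidHom.id _) fun _ => rfl
  have hf : f.IsCovering := twistMap_isCovering (basePerm_isCovering hσ) Function.surjective_id _
  refine ⟨hf.toAut (twistMap_onV_injective hinj Function.injective_id _), ?_⟩
  cases v <;> exact hzero

theorem finite_orbitRel_quotient {G A : Type*} [Group G] [MulAction G A] {S : Set A}
    (hS : S.Finite) (h : ∀ a, ∃ g : G, g • a ∈ S) :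
    Finite (MulAction.orbitRel.Quotient G A) := by
  have := hS.to_subtype
  refine Finite.of_surjective
    (fun s : S => (Quotient.mk'' s.1 : MulAction.orbitRel.Quotient G A)) fun q => ?_
  induction q using Quotient.inductionOn' with
  | h a =>
    obtain ⟨g, hg⟩ := h a
    exact ⟨⟨_, hg⟩, Quotient.sound' (s₁ := MulAction.orbitRel G A) ⟨g, rfl⟩⟩

theorem LocallyFinite.isCocompact {X : SerreGraph} (hX : X.LocallyFinite) {S : Set X.V}
    (hS : S.Finite) (h : ∀ v, ∃ γ : X.Aut, γ • v ∈ S) : X.IsCocompact := by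
  constructor
  · refine finite_orbitRel_quotient hS fun v => ?_
    obtain ⟨γ, hγ⟩ := h v
    exact ⟨⟨γ, trivial⟩, hγ⟩
  · refine finite_orbitRel_quotient (hS.biUnion fun v _ => hX v) fun e => ?_
    obtain ⟨γ, hγ⟩ := h (X.src e)
    exact ⟨⟨γ, trivial⟩, Set.mem_biUnion hγ (src_smul γ e)⟩

theorem quasitree_locallyFinite : quasitree.LocallyFinite :=
  twist_locallyFinite ofPorts_locallyFinite

theorem quasitree_isCocompact : quasitree.IsCocompact := by
  refine quasitree_locallyFinite.isCocompact (S := {v | vertexNode v = 0}) ?_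
    exists_aut_vertexNode_eq_zero
  refine (Set.finite_range (Sum.elim
    (fun p : Letter × ZMod 2 × ZMod 3 => core (0, p.1) p.2)
    fun p : Letter × ZMod 2 × ZMod 3 => hub (0, p.1) p.2)).subset ?_
  rintro (⟨⟨ν, l⟩, f⟩ | ⟨⟨ν, l⟩, f⟩) (rfl : ν = 0)
  · exact ⟨.inl (l, f), rfl⟩
  · exact ⟨.inr (l, f), rfl⟩

/-! ### The tree of nodes -/

section ParentGraph

variable {V : Type*} {p : V → V}

/-- The graph in which every vertex is joined to its parent. -/
def parentGraph (p : V → V) : SimpleGraph V := .fromRel fun v w => w = p v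

theorem parentGraph_edist_parent_le (v : V) : (parentGraph p).edist v (p v) ≤ 1 := by
  rw [SimpleGraph.edist_le_one_iff_adj_or_eq]
  by_cases hv : v = p v
  · exact .inr hv
  · exact .inl ⟨hv, .inl rfl⟩

theorem parentGraph_connected [Nonempty V] (h : ∀ v w, ∃ m n, p^[m] v = p^[n] w) :
    (parentGraph p).Connected := by
  have hparent (v : V) : (parentGraph p).Reachable v (p v) :=
    SimpleGraph.reachable_of_edist_ne_top
      (ne_top_of_le_ne_top ENat.one_ne_top (parentGraph_edist_parent_le v))
  have hiterate (n : ℕ) (v : V) : (parentGraph p).Reachable v (p^[n] v) := by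
    induction n with
    | zero => rfl
    | succ n ih =>
      rw [Function.iterate_succ_apply']
      exact ih.trans (hparent _)
  refine ⟨fun v w => ?_⟩
  obtain ⟨m, n, hmn⟩ := h v w
  exact (hiterate m v).trans (hmn ▸ (hiterate n w).symm)

/-- At a vertex of maximal level on a cycle both neighbours would be the parent. -/
theorem parentGraph_isAcyclic {L : Type*} [LinearOrder L] (level : V → L)
    (h : ∀ v, level (p v) < level v) : (parentGraph p).IsAcyclic := by
  classical
  intro v₀ c₀ hc₀
  obtain ⟨v, hv, hmax⟩ := c₀.support.toFinset.exists_max_image level ⟨v₀, by simp⟩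
  rw [List.mem_toFinset] at hv
  let c := c₀.rotate v hv
  have hc : c.IsCycle := hc₀.rotate hv
  have eq_parent {w : V} (hw : w ∈ c.support) (hadj : (parentGraph p).Adj v w) : w = p v := by
    refine hadj.2.resolve_right fun hvw => ?_
    have hle : level w ≤ level v :=
      hmax w (List.mem_toFinset.mpr ((c₀.mem_support_rotate_iff v hv).mp hw))
    exact (hvw ▸ h w).not_ge hle
  refine hc.snd_ne_penultimate ?_
  exact (eq_parent (c.getVert_mem_support _) (c.adj_snd hc.not_nil)).trans
    (eq_parent (c.getVert_mem_support _) (c.adj_penultimate hc.not_nil).symm).symm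

end ParentGraph

/-- The tree of nodes. -/
def nodeTree : SimpleGraph Node := parentGraph parent

theorem Node.parent_iterate (n : ℕ) (ν : Node) : parent^[n] ν = (ν.1 - n, ν.2 / 2 ^ n) := by
  induction n with
  | zero => simp
  | succ n ih =>
    rw [Function.iterate_succ_apply', ih, parent, Nat.div2_val, Nat.div_div_eq_div_mul, ← pow_succ]
    push_cast
    rw [sub_sub]

theorem nodeTree_isTree : nodeTree.IsTree := by
  refine ⟨parentGraph_connected fun ν μ => ?_,
    parentGraph_isAcyclic Prod.fst fun ν => sub_one_lt ν.1⟩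
  refine ⟨ν.2 + μ.2 + (ν.1 - μ.1).toNat, ν.2 + μ.2 + (μ.1 - ν.1).toNat, ?_⟩
  have hdiv (k n : ℕ) (hk : k ≤ n) : k / 2 ^ n = 0 :=
    Nat.div_eq_of_lt (hk.trans_lt n.lt_two_pow_self)
  rw [parent_iterate, parent_iterate, hdiv _ _ (by omega), hdiv _ _ (by omega)]
  exact Prod.ext (by push_cast; omega) rfl

/-! ### The quasi-isometry -/

section QuasiIsometry

variable {V W : Type} {G : SimpleGraph V} {H : SimpleGraph W}

theorem edist_le_add {x y z : V} {m n : ℕ∞} (hxy : G.edist x y ≤ m) (hyz : G.edist y z ≤ n) :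
    G.edist x z ≤ m + n :=
  SimpleGraph.edist_triangle.trans (add_le_add hxy hyz)

theorem edist_map_le_mul_length {f : V → W} {K : ℕ∞}
    (hf : ∀ x y, G.Adj x y → H.edist (f x) (f y) ≤ K) {x y : V} (w : G.Walk x y) :
    H.edist (f x) (f y) ≤ K * w.length := by
  induction w with
  | nil => simp
  | cons hadj w ih =>
    rw [SimpleGraph.Walk.length_cons, Nat.cast_succ, mul_add, mul_one, add_comm]
    exact edist_le_add (hf _ _ hadj) ih

theorem dist_le_of_edist_le {x y : V} {n : ℕ} (h : G.edist x y ≤ n) : G.dist x y ≤ n :=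
  ENat.toNat_le_of_le_natCast h

theorem isGraphQuasiIsometry_of_coarse_inverse (hH : H.Connected) {f : V → W} {g : W → V} {K C : ℕ}
    (hf : ∀ x y, G.Adj x y → H.edist (f x) (f y) ≤ K)
    (hg : ∀ x y, H.Adj x y → G.edist (g x) (g y) ≤ K)
    (hgf : ∀ x, G.edist x (g (f x)) ≤ C) (hfg : ∀ w, H.edist (f (g w)) w ≤ C) :
    G.Connected ∧ IsGraphQuasiIsometry G H f := by
  have hdist (x y : V) : G.edist x y ≤ (C + K * H.dist (f x) (f y) + C : ℕ) := by
    obtain ⟨w, hw⟩ := hH.exists_walk_length_eq_dist (f x) (f y)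
    have hmid := edist_map_le_mul_length hg w
    rw [hw] at hmid
    have hend : G.edist (g (f y)) y ≤ C := SimpleGraph.edist_comm.trans_le (hgf y)
    exact_mod_cast edist_le_add (edist_le_add (hgf x) hmid) hend
  have : Nonempty V := hH.nonempty.map g
  have hconn : G.Connected := ⟨fun x y => SimpleGraph.reachable_of_edist_ne_top
    (ne_top_of_le_ne_top (ENat.natCast_ne_top _) (hdist x y))⟩
  have hupper (x y : V) : H.dist (f x) (f y) ≤ K * G.dist x y := by
    obtain ⟨w, hw⟩ := hconn.exists_walk_length_eq_dist x y
    have hmap := edist_map_le_mul_length hf w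
    rw [hw] at hmap
    exact dist_le_of_edist_le (by exact_mod_cast hmap)
  refine ⟨hconn, K + 1, 2 * C, by simp, by positivity, fun x y => ⟨?_, ?_⟩, fun w => ⟨g w, ?_⟩⟩
  · have hle : (G.dist x y : ℝ) ≤ C + K * H.dist (f x) (f y) + C := by
      exact_mod_cast dist_le_of_edist_le (hdist x y)
    rw [sub_le_iff_le_add, div_le_iff₀ (by positivity)]
    linarith [show (0 : ℝ) ≤ H.dist (f x) (f y) + 2 * C * K by positivity]
  · have hle : (H.dist (f x) (f y) : ℝ) ≤ K * G.dist x y := by exact_mod_cast hupper x y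
    linarith [show (0 : ℝ) ≤ G.dist x y + 2 * C by positivity]
  · have hle : (H.dist (f (g w)) w : ℝ) ≤ C := by exact_mod_cast dist_le_of_edist_le (hfg w)
    linarith [Nat.cast_nonneg (α := ℝ) C]

end QuasiIsometry

theorem edist_src_tgt_le {X : SerreGraph} (e : X.E) :
    X.toSimple.edist (X.src e) (X.tgt e) ≤ 1 := by
  rw [SimpleGraph.edist_le_one_iff_adj_or_eq]
  by_cases h : X.src e = X.tgt e
  · exact .inr h
  · exact .inl ⟨h, e, rfl, rfl⟩

section Twist

variable {F : Type} [AddCommGroup F] {Y : SerreGraph} {α : Y.V → F}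

theorem edist_hub_core_le (v : Y.V) (f : F) (s : Fin 3) :
    (twist Y α).toSimple.edist (hub v f) (core v (f + spokeShift (α v) s)) ≤ 1 :=
  edist_src_tgt_le (X := twist Y α) (spoke v f s false)

theorem edist_core_core_add_nsmul_le (v : Y.V) (f : F) (n : ℕ) :
    (twist Y α).toSimple.edist (core v f) (core v (f + n • α v)) ≤ 2 * n := by
  induction n with
  | zero => simp
  | succ n ih =>
    have hfrom := edist_hub_core_le (α := α) v (f + n • α v) 0
    have hto := edist_hub_core_le (α := α) v (f + n • α v) 1
    rw [show spokeShift (α v) 0 = 0 from rfl, add_zero, SimpleGraph.edist_comm] at hfrom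
    rw [show spokeShift (α v) 1 = α v from rfl, add_assoc, ← succ_nsmul] at hto
    have hstep := edist_le_add ih (edist_le_add hfrom hto)
    rwa [one_add_one_eq_two, ← mul_add_one, ← Nat.cast_succ] at hstep

end Twist

/-- The vertex of the quasitree that represents a node. -/
def nodeVertex (ν : Node) : quasitree.V := core (ν, .a) 0

theorem edist_core_a_b_le (ν : Node) (f : ZMod 2 × ZMod 3) :
    quasitree.toSimple.edist (core (ν, .a) f) (core (ν, .b) f) ≤ 1 :=
  edist_src_tgt_le (X := quasitree) (link (((ν, .a), some false), true) f)

theorem edist_core_a_c_le (ν : Node) (f : ZMod 2 × ZMod 3) :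
    quasitree.toSimple.edist (core (ν, .a) f) (core (ν, .c) f) ≤ 1 :=
  edist_src_tgt_le (X := quasitree) (link (((ν, .a), some true), true) f)

theorem edist_core_b_c_le (x : Bool) (ν : Node) (f : ZMod 2 × ZMod 3) :
    quasitree.toSimple.edist (core (ν, .b) f) (core (child x ν, .c) f) ≤ 1 :=
  edist_src_tgt_le (X := quasitree) (link (((ν, .b), some x), true) f)

theorem edist_nodeVertex_parent_le (ν : Node) :
    quasitree.toSimple.edist (nodeVertex ν) (nodeVertex (parent ν)) ≤ 3 := by
  have hcb := edist_core_b_c_le (digit ν) (parent ν) 0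
  rw [child_digit_parent, SimpleGraph.edist_comm] at hcb
  have hba := SimpleGraph.edist_comm.trans_le (edist_core_a_b_le (parent ν) 0)
  exact (edist_le_add (edist_le_add (edist_core_a_c_le ν 0) hcb) hba).trans (by norm_num)

theorem edist_nodeVertex_core_le (ν : Node) (f : ZMod 2 × ZMod 3) :
    quasitree.toSimple.edist (nodeVertex ν) (core (ν, .a) f) ≤ 8 := by
  have hb := edist_core_core_add_nsmul_le (Y := base) (α := fun v => letterTwist v.2) (ν, .b) 0
    f.2.val
  have ha := edist_core_core_add_nsmul_le (Y := base) (α := fun v => letterTwist v.2) (ν, .a)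
    (0, f.2) f.1.val
  rw [show 0 + f.2.val • letterTwist .b = (0, f.2) by simp [letterTwist]] at hb
  rw [show (0, f.2) + f.1.val • letterTwist .a = f by simp [letterTwist]] at ha
  have hback := SimpleGraph.edist_comm.trans_le (edist_core_a_b_le ν (0, f.2))
  refine (edist_le_add (edist_le_add (edist_le_add (edist_core_a_b_le ν 0) hb) hback) ha).trans ?_
  have h₁ := f.1.val_lt
  have h₂ := f.2.val_lt
  exact_mod_cast (by omega : 1 + 2 * f.2.val + 1 + 2 * f.1.val ≤ 8)

theorem edist_vertexNode_le (x : quasitree.V) :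
    quasitree.toSimple.edist (nodeVertex (vertexNode x)) x ≤ 10 := by
  have hcore (v : Node × Letter) (f : ZMod 2 × ZMod 3) :
      quasitree.toSimple.edist (nodeVertex v.1) (core v f) ≤ 9 := by
    have ha := edist_nodeVertex_core_le v.1 f
    rcases v with ⟨ν, _ | _ | _⟩
    · exact ha.trans (by norm_num)
    · exact (edist_le_add ha (edist_core_a_b_le ν f)).trans (by norm_num)
    · exact (edist_le_add ha (edist_core_a_c_le ν f)).trans (by norm_num)
  rcases x with ⟨v, f⟩ | ⟨v, f⟩
  · exact (hcore v f).trans (by norm_num)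
  · have hhub := edist_hub_core_le (Y := base) (α := fun v => letterTwist v.2) v f 0
    rw [SimpleGraph.edist_comm] at hhub
    exact (edist_le_add (hcore v _) hhub).trans (by norm_num)

theorem edist_vertexNode_src_tgt_le (e : quasitree.E) :
    nodeTree.edist (vertexNode (quasitree.src e)) (vertexNode (quasitree.tgt e)) ≤ 1 := by
  have hself (ν : Node) : nodeTree.edist ν ν ≤ 1 := by simp
  rcases e with ⟨⟨⟨⟨ν, _ | _ | _⟩, _ | x⟩, j⟩, f⟩ | ⟨v, f, s, _ | _⟩
  · exact hself ν
  · cases x <;> exact hself ν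
  · exact hself ν
  · have h := parentGraph_edist_parent_le (p := parent) (child x ν)
    rwa [parent_child, SimpleGraph.edist_comm] at h
  · exact hself ν
  · have hparent : nodeTree.edist ν (parent ν) ≤ 1 := parentGraph_edist_parent_le ν
    by_cases h : x = digit ν
    · simpa [tgt, basePort, vertexNode, h] using hparent
    · simp [tgt, basePort, vertexNode, h]
  · exact hself v.1
  · exact hself v.1

theorem quasitree_isQuasitree : quasitree.IsQuasitree := by
  have hqi := isGraphQuasiIsometry_of_coarse_inverse (G := quasitree.toSimple) nodeTree_isTree.1
    (f := vertexNode) (g := nodeVertex) (K := 3) (C := 10) ?_ ?_ ?_ ?_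
  · exact ⟨quasitree_locallyFinite, hqi.1, Node, nodeTree, nodeTree_isTree, vertexNode, hqi.2⟩
  · rintro _ _ ⟨-, e, rfl, rfl⟩
    exact (edist_vertexNode_src_tgt_le e).trans (by norm_num)
  · rintro ν μ ⟨-, rfl | rfl⟩
    · exact edist_nodeVertex_parent_le ν
    · exact SimpleGraph.edist_comm.trans_le (edist_nodeVertex_parent_le μ)
  · exact fun x => SimpleGraph.edist_comm.trans_le (edist_vertexNode_le x)
  · exact fun ν => SimpleGraph.edist_self.trans_le zero_le

/-! ### The finite quotients and the colours they detect -/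

/-- The twists of the vertices of `left`. -/
def leftTwist (u : Option Bool) : ZMod 2 := if u = none then 1 else 0

/-- The twists of the vertices of `right`. -/
def rightTwist (u : Option (ZMod 3)) : ZMod 3 := if u = none then 1 else 0

/-- The finite quotient in which the vertices `a` are detected by a twist of order two. -/
abbrev leftQuotient : SerreGraph := twist left leftTwist

/-- The finite quotient in which the vertices `b` are detected by a twist of order three. -/
abbrev rightQuotient : SerreGraph := twist right rightTwist

theorem leftQuotient_isFinite : leftQuotient.IsFinite := twist_isFinite ofPorts_isFinite

theorem rightQuotient_isFinite : rightQuotient.IsFinite := twist_isFinite ofPorts_isFinite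

theorem quasitree_covers_leftQuotient : quasitree.Covers leftQuotient := by
  refine ⟨_, twistMap_isCovering baseToLeft_isCovering (φ := AddMonoidHom.fst (ZMod 2) (ZMod 3))
    Prod.fst_surjective ?_⟩
  rintro ⟨ν, _ | _ | _⟩ <;> rfl

theorem quasitree_covers_rightQuotient : quasitree.Covers rightQuotient := by
  refine ⟨_, twistMap_isCovering baseToRight_isCovering (φ := AddMonoidHom.snd (ZMod 2) (ZMod 3))
    Prod.snd_surjective ?_⟩
  rintro ⟨ν, _ | _ | _⟩ <;> rfl

theorem eq_none_iff_of_left {p : Hom quasitree leftQuotient} (hp : p.IsCovering)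
    {v : Node × Letter} {f : ZMod 2 × ZMod 3} {u : Option Bool} {i : ZMod 2}
    (h : p.onV (core v f) = core u i) : u = none ↔ v.2 = .a := by
  refine hp.onV_core_mem_iff (S := {v : base.V | v.2 = .a}) (S' := {u : left.V | u = none})
    ofPorts_starAt_nonempty ofPorts_starAt_nonempty ?_ ?_ ?_ h
  · rintro ⟨ν, t⟩ ht _ rfl hdvd
    have hthree : 3 • letterTwist t = 0 := by
      cases t
      · exact absurd rfl ht
      · decide
      · decide
    have hone : 3 • (1 : ZMod 2) = 0 :=
      addOrderOf_dvd_iff_nsmul_eq_zero.mp (hdvd.trans (addOrderOf_dvd_of_nsmul_eq_zero hthree))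
    exact absurd hone (by decide)
  · rintro (_ | i) hu
    · exact absurd rfl hu
    · exact ⟨((some i, none), true), rfl, rfl⟩
  · rintro ⟨ν, _⟩ rfl
    refine ⟨(ν, .b), nofun, ?_⟩
    rintro ⟨⟨w, _ | x⟩, j⟩ (rfl : w = (ν, .b)) ht
    · rfl
    · cases ht

theorem eq_none_iff_of_right {q : Hom quasitree rightQuotient} (hq : q.IsCovering)
    {v : Node × Letter} {f : ZMod 2 × ZMod 3} {u : Option (ZMod 3)} {i : ZMod 3}
    (h : q.onV (core v f) = core u i) : u = none ↔ v.2 = .b := by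
  refine hq.onV_core_mem_iff (S := {v : base.V | v.2 = .b}) (S' := {u : right.V | u = none})
    ofPorts_starAt_nonempty ofPorts_starAt_nonempty ?_ ?_ ?_ h
  · rintro ⟨ν, t⟩ ht _ rfl hdvd
    have htwo : 2 • letterTwist t = 0 := by
      cases t
      · decide
      · exact absurd rfl ht
      · decide
    have hone : 2 • (1 : ZMod 3) = 0 :=
      addOrderOf_dvd_iff_nsmul_eq_zero.mp (hdvd.trans (addOrderOf_dvd_of_nsmul_eq_zero htwo))
    exact absurd hone (by decide)
  · rintro (_ | i) hu
    · exact absurd rfl hu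
    · exact ⟨((some i, 0), true), rfl, rfl⟩
  · rintro ⟨ν, _⟩ rfl
    refine ⟨(child false ν, .c), nofun, ?_⟩
    rintro ⟨⟨w, _ | x⟩, j⟩ (rfl : w = (child false ν, .c)) ht
    · cases ht
    · by_cases hx : x = false
      · simp [tgt, basePort, hx]
      · simp [tgt, basePort, hx] at ht

/-- The colour of a vertex of the quasitree: the letter below it, with a separate colour for the
hubs. -/
abbrev vertexColor : quasitree.V → Option Letter := twistColor Prod.snd

/-- The colour of a vertex, in terms of its images in the two finite quotients. -/
def jointColor : leftQuotient.V → rightQuotient.V → Option Letter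
  | core none _, _ => some .a
  | core (some _) _, core none _ => some .b
  | core (some _) _, core (some _) _ => some .c
  | _, _ => none

theorem jointColor_eq {p : Hom quasitree leftQuotient} (hp : p.IsCovering)
    {q : Hom quasitree rightQuotient} (hq : q.IsCovering) (x : quasitree.V) :
    jointColor (p.onV x) (q.onV x) = vertexColor x := by
  rcases x with ⟨v, f⟩ | ⟨v, f⟩
  · obtain ⟨u, i, hu⟩ := hp.exists_onV_core ofPorts_starAt_nonempty v f
    obtain ⟨w, j, hw⟩ := hq.exists_onV_core ofPorts_starAt_nonempty v f
    have ha := eq_none_iff_of_left hp hu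
    have hb := eq_none_iff_of_right hq hw
    rw [hu, hw]
    rcases v with ⟨ν, _ | _ | _⟩ <;> rcases u with _ | u <;> rcases w with _ | w <;>
      first | rfl | simp at ha hb
  · obtain ⟨u, i, hu⟩ := hp.exists_onV_hub ofPorts_starAt_nonempty v f
    rw [hu]
    rfl

theorem vertexColor_smul (γ : quasitree.Aut) (x : quasitree.V) :
    vertexColor ((autHom γ).onV x) = vertexColor x := by
  obtain ⟨p, hp⟩ := quasitree_covers_leftQuotient
  obtain ⟨q, hq⟩ := quasitree_covers_rightQuotient
  calc vertexColor ((autHom γ).onV x)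
      = jointColor (p.onV ((autHom γ).onV x)) (q.onV ((autHom γ).onV x)) :=
        (jointColor_eq hp hq _).symm
    _ = vertexColor x :=
        jointColor_eq (hp.comp (autHom_isCovering γ)) (hq.comp (autHom_isCovering γ)) x

/-! ### Irreversibility -/

/-- The number of ports of a vertex `s` of the base graph that lead to vertices `t`. -/
def portCount : Letter → Letter → ℕ
  | .b, .b => 0
  | .b, .c => 2
  | _, _ => 1

/-- The letter of the neighbour at a port, in terms of the letter and the digit of the vertex. -/
def portLetter : Letter → Bool → Option Bool → Letter
  | _, _, none => .a
  | .a, _, some x => bif x then .c else .b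
  | .b, _, some _ => .c
  | .c, y, some x => if x = y then .b else .c

theorem basePort_letter (v : Node × Letter) (p : Option Bool) :
    (basePort (v, p)).1.2 = portLetter v.2 (digit v.1) p := by
  rcases v with ⟨ν, _ | _ | _⟩ <;> rcases p with _ | x
  · rfl
  · cases x <;> rfl
  · rfl
  · rfl
  · rfl
  · by_cases h : x = digit ν
    · simp only [basePort, portLetter, if_pos h]
    · simp only [basePort, portLetter, if_neg h]

theorem basePort_encard (v : Node × Letter) (t : Letter) :
    {p | (basePort (v, p)).1.2 = t}.encard = portCount v.2 t := by
  have hcard : ∀ s y, ({p | portLetter s y p = t} : Finset (Option Bool)).card = portCount s t := by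
    rintro (_ | _ | _) y <;> revert y <;> cases t <;> decide
  simp only [basePort_letter, ← hcard v.2 (digit v.1)]
  rw [← Set.encard_coe_eq_coe_finsetCard, Finset.coe_filter_univ]

theorem vertexColor_hasEdgeCount (s t : Letter) :
    HasEdgeCount quasitree vertexColor (some s) (some t) (2 * portCount s t) :=
  HasEdgeCount.twist <| ofPorts_hasEdgeCount fun v hv => hv ▸ basePort_encard v t

/-- The edge counts along the cycle of colours `a`, `b`, `c` violate Kolmogorov's criterion. -/
theorem not_hasEdgeCount_portCount {Z : SerreGraph} {Γ : Subgroup Z.Aut} (hp : ActsProperly Γ)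
    (hc : ActsCocompactly Γ) {τ : Z.V → Option Letter} (hτ : ∀ (γ : Γ) v, τ (γ • v) = τ v)
    (ha : ∃ v, τ v = some .a) :
    ¬ ∀ s t, HasEdgeCount Z τ (some s) (some t) (2 * portCount s t) := fun h =>
  absurd (HasEdgeCount.cycle_criterion hp hc hτ ha (h .a .b) (h .b .a) (h .b .c) (h .c .b)
    (h .c .a) (h .a .c)) (by decide)

theorem actsProperly_bot {Z : SerreGraph} : ActsProperly (⊥ : Subgroup Z.Aut) :=
  fun _ _ => Set.toFinite _

theorem IsFinite.actsCocompactly {Z : SerreGraph} (hZ : Z.IsFinite) (Γ : Subgroup Z.Aut) :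
    ActsCocompactly Γ := by
  have := hZ.1
  have := hZ.2
  exact ⟨Quotient.finite _, Quotient.finite _⟩

theorem not_exists_common_quotient : ¬ ∃ Z : SerreGraph, Z.IsFinite ∧ quasitree.Covers Z ∧
    Z.Covers leftQuotient ∧ Z.Covers rightQuotient := by
  rintro ⟨Z, hZ, ⟨ψ, hψ⟩, ⟨p, hp⟩, q, hq⟩
  let τ : Z.V → Option Letter := fun z => jointColor (p.onV z) (q.onV z)
  have hcomp : τ ∘ ψ.onV = vertexColor := funext (jointColor_eq (hp.comp hψ) (hq.comp hψ))
  have hinv : ∀ (γ : (⊥ : Subgroup Z.Aut)) z, τ (γ • z) = τ z := fun γ z => by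
    rw [Subsingleton.elim γ 1, one_smul]
  have ha : ∃ z, τ z = some .a := ⟨ψ.onV (nodeVertex 0), congrFun hcomp (nodeVertex 0)⟩
  refine not_hasEdgeCount_portCount actsProperly_bot (hZ.actsCocompactly ⊥) hinv ha fun s t => ?_
  exact HasEdgeCount.of_covering hψ (hcomp ▸ vertexColor_hasEdgeCount s t)

theorem not_exists_isUniformLattice_quasitree :
    ¬ ∃ Γ : Subgroup quasitree.Aut, IsUniformLattice Γ := by
  rintro ⟨Γ, -, hp, hc⟩
  exact not_hasEdgeCount_portCount hp hc (fun γ v => vertexColor_smul γ v) ⟨nodeVertex 0, rfl⟩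
    vertexColor_hasEdgeCount

end SerreGraph

theorem theorem4p2 :
    ∃ X X₁ X₂ : SerreGraph,
      X.IsQuasitree ∧ X.IsCocompact ∧
      X₁.IsFinite ∧ X₂.IsFinite ∧
      X.Covers X₁ ∧ X.Covers X₂ ∧
      (¬ ∃ Xhat : SerreGraph, Xhat.IsFinite ∧ X.Covers Xhat ∧ Xhat.Covers X₁ ∧ Xhat.Covers X₂) ∧
      ¬ ∃ Γ : Subgroup X.Aut, SerreGraph.IsUniformLattice Γ :=
  ⟨SerreGraph.quasitree, SerreGraph.leftQuotient, SerreGraph.rightQuotient,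
    SerreGraph.quasitree_isQuasitree, SerreGraph.quasitree_isCocompact,
    SerreGraph.leftQuotient_isFinite, SerreGraph.rightQuotient_isFinite,
    SerreGraph.quasitree_covers_leftQuotient, SerreGraph.quasitree_covers_rightQuotient,
    SerreGraph.not_exists_common_quotient, SerreGraph.not_exists_isUniformLattice_quasitree⟩
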